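/- Let $T\subset\mathbb R^3$ be the closed triangle with affinely independent vertices $p_1,p_2,p_3$ (indices cyclic modulo $3$), and put $s_i=p_{i-1}-p_{i+1}$ (so $s_1=p_3-p_2$, $s_2=p_1-p_3$, $s_3=p_2-p_1$), $\ell_i=|s_i|$, $\hat s_i=s_i/\ell_i$, $$\hat w=\frac{\hat s_1\times\hat s_2}{|\hat s_1\times\hat s_2|},\qquad \hat u=\hat s_3,\qquad \hat v=\hat w\times\hat u,\qquad \hat m_i=\hat s_i\times\hat w\quad(i=1,2,3),$$ and $u_3=-s_2\cdot\hat u$, $v_3=-s_2\cdot\hat v$. Let the unit normal of $T$ be $\hat n=\hat w$. Let $r_0\in\mathbb R^3\setminus T$ (the position of the dipole) and $q\in\mathbb R^3$ (its moment), and let $u_0,v_0,w_0$ be defined by $r_0=p_1+u_0\hat u+v_0\hat v-w_0\hat w$. Put $$t_1^0=\frac{v_0(u_3-\ell_3)+v_3(\ell_3-u_0)}{\ell_1},\qquad t_2^0=\frac{u_0v_3-v_0u_3}{\ell_2},\qquad t_3^0=v_0,$$ $$s_1^-=-\frac{(\ell_3-u_0)(\ell_3-u_3)+v_0v_3}{\ell_1},\qquad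 s_1^+=\frac{(u_3-u_0)(u_3-\ell_3)+v_3(v_3-v_0)}{\ell_1},$$ $$s_2^-=-\frac{u_3(u_3-u_0)+v_3(v_3-v_0)}{\ell_2},\qquad s_2^+=\frac{u_0u_3+v_0v_3}{\ell_2},\qquad s_3^-=-u_0,\qquad s_3^+=\ell_3-u_0,$$ $$R_i^0=\sqrt{(t_i^0)^2+w_0^2},\qquad R_i^\pm=\sqrt{(s_i^\pm)^2+(t_i^0)^2+w_0^2},\qquad R_i^s=\frac1{(R_i^0)^2}\left(\frac{s_i^+}{R_i^+}-\frac{s_i^-}{R_i^-}\right).$$ If $R_i^0=0$, i.e. if $r_0$ lies on the line through the side opposite to $p_i$, we set $R_i^s=0$; its value is then irrelevant, because $w_0=t_i^0=0$. With $R=r-r_0$, the function $r\mapsto \hat n\cdot\nabla_r\!\left(\dfrac{q\cdot R}{|R|^3}\right)$ is integrable on $T$ with respect to surface area, and $$I_0:=\int_T \hat n\cdot\nabla_r\!\left(\frac{q\cdot R}{|R|^3}\right)dS(r)\;=\;q\cdot\sum_{i=1}^3 R_i^s\left(w_0\,\hat m_i-t_i^0\,\hat w\right).$$ -/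

import Mathlib

open MeasureTheory
open scoped InnerProductSpace

/-- Euclidean three-space (global Cartesian frame). -/
abbrev E3 : Type := EuclideanSpace ℝ (Fin 3)

/-- The cross product on Euclidean three-space. -/
noncomputable def cross3 (a b : E3) : E3 :=
  WithLp.toLp 2 (crossProduct a.ofLp b.ofLp)

/-- The dipole potential kernel `f(r) = q · R / R³`, where `R = r - r₀` and `R = |R|`. -/
noncomputable def dipoleKernel (q r₀ r : E3) : ℝ :=
  ⟪q, r - r₀⟫_ℝ / ‖r - r₀‖ ^ 3

namespace Tri

/- The nodes `p₁, p₂, p₃` of the triangle are `p 0, p 1, p 2`, the indices being cyclic (`Fin 3`);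
side `i` is the side opposite to node `i`. -/

/-- The (closed, filled) triangle with nodes `p`. -/
def tri (p : Fin 3 → E3) : Set E3 := convexHull ℝ (Set.range p)

/-- Side vectors `sᵢ = pᵢ₋₁ - pᵢ₊₁`. -/
noncomputable def side (p : Fin 3 → E3) (i : Fin 3) : E3 := p (i - 1) - p (i + 1)

/-- Side lengths `sᵢ = |sᵢ|`. -/
noncomputable def len (p : Fin 3 → E3) (i : Fin 3) : ℝ := ‖side p i‖

/-- Unit side vectors `ŝᵢ = sᵢ / |sᵢ|`. -/
noncomputable def sHat (p : Fin 3 → E3) (i : Fin 3) : E3 := (len p i)⁻¹ • side p i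

/-- The unit vector `ŵ` normal to the triangle: the normalisation of `ŝ₁ × ŝ₂`. -/
noncomputable def wHat (p : Fin 3 → E3) : E3 :=
  ‖cross3 (sHat p 0) (sHat p 1)‖⁻¹ • cross3 (sHat p 0) (sHat p 1)

/-- `û = ŝ₃`. -/
noncomputable def uHat (p : Fin 3 → E3) : E3 := sHat p 2

/-- `v̂ = ŵ × û`. -/
noncomputable def vHat (p : Fin 3 → E3) : E3 := cross3 (wHat p) (uHat p)

/-- `m̂ᵢ = ŝᵢ × ŵ`, the in-plane normal to side `i`. -/
noncomputable def mHat (p : Fin 3 → E3) (i : Fin 3) : E3 := cross3 (sHat p i) (wHat p)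

/-- `u₃`, the first local coordinate of the node `p₃`. -/
noncomputable def u3 (p : Fin 3 → E3) : ℝ := -⟪side p 1, uHat p⟫_ℝ

/-- `v₃`, the second local coordinate of the node `p₃`. -/
noncomputable def v3 (p : Fin 3 → E3) : ℝ := -⟪side p 1, vHat p⟫_ℝ

/- The source is `r₀ = p₁ + u₀ û + v₀ v̂ - w₀ ŵ`; note the sign of `w₀`. -/

/-- `u₀`. -/
noncomputable def u0 (p : Fin 3 → E3) (r₀ : E3) : ℝ := ⟪r₀ - p 0, uHat p⟫_ℝ

/-- `v₀`. -/
noncomputable def v0 (p : Fin 3 → E3) (r₀ : E3) : ℝ := ⟪r₀ - p 0, vHat p⟫_ℝ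

/-- `w₀`. -/
noncomputable def w0 (p : Fin 3 → E3) (r₀ : E3) : ℝ := -⟪r₀ - p 0, wHat p⟫_ℝ

/-- `tᵢ⁰`, the signed in-plane distance from the projection `ρ` of `r₀` to the line through
side `i`. -/
noncomputable def t0 (p : Fin 3 → E3) (r₀ : E3) : Fin 3 → ℝ :=
  ![(v0 p r₀ * (u3 p - len p 2) + v3 p * (len p 2 - u0 p r₀)) / len p 0,
    (u0 p r₀ * v3 p - v0 p r₀ * u3 p) / len p 1,
    v0 p r₀]

/-- `sᵢ⁻`, the abscissa along `ŝᵢ`, measured from the foot of `ρ`, of the starting point `pᵢ₊₁`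
of side `i`. -/
noncomputable def sMinus (p : Fin 3 → E3) (r₀ : E3) : Fin 3 → ℝ :=
  ![-((len p 2 - u0 p r₀) * (len p 2 - u3 p) + v0 p r₀ * v3 p) / len p 0,
    -(u3 p * (u3 p - u0 p r₀) + v3 p * (v3 p - v0 p r₀)) / len p 1,
    -u0 p r₀]

/-- `sᵢ⁺`, the abscissa along `ŝᵢ`, measured from the foot of `ρ`, of the end point `pᵢ₋₁`
of side `i`. -/
noncomputable def sPlus (p : Fin 3 → E3) (r₀ : E3) : Fin 3 → ℝ :=
  ![((u3 p - u0 p r₀) * (u3 p - len p 2) + v3 p * (v3 p - v0 p r₀)) / len p 0,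
    (u0 p r₀ * u3 p + v0 p r₀ * v3 p) / len p 1,
    len p 2 - u0 p r₀]

/-- `Rᵢ⁰`, the distance from `r₀` to the line through side `i`. -/
noncomputable def R0 (p : Fin 3 → E3) (r₀ : E3) (i : Fin 3) : ℝ :=
  √(t0 p r₀ i ^ 2 + w0 p r₀ ^ 2)

/-- `Rᵢ⁻`. -/
noncomputable def RMinus (p : Fin 3 → E3) (r₀ : E3) (i : Fin 3) : ℝ :=
  √(sMinus p r₀ i ^ 2 + t0 p r₀ i ^ 2 + w0 p r₀ ^ 2)

/-- `Rᵢ⁺`. -/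
noncomputable def RPlus (p : Fin 3 → E3) (r₀ : E3) (i : Fin 3) : ℝ :=
  √(sPlus p r₀ i ^ 2 + t0 p r₀ i ^ 2 + w0 p r₀ ^ 2)

/-- `Rᵢˢ`. If `Rᵢ⁰ = 0` (the source lies on the line through side `i`), this is `0` by the
convention for division; its value is then immaterial, as `w₀ = tᵢ⁰ = 0`. -/
noncomputable def Rs (p : Fin 3 → E3) (r₀ : E3) (i : Fin 3) : ℝ :=
  1 / R0 p r₀ i ^ 2 * (sPlus p r₀ i / RPlus p r₀ i - sMinus p r₀ i / RMinus p r₀ i)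

end Tri

/-!
Write `R = r - r₀`. Away from `r₀` one has `∇ (q · R / R³) = -curl (q × R / R³)`, so by Stokes'
theorem the flux through the triangle is minus the circulation of `q × R / R³` along its boundary.
On side `i` the vector `R × ŝᵢ` is constant, so the circulation along that side is
`q · (R × ŝᵢ)` times the elementary integral `∫ dl / R³ = Rᵢˢ`, and
`ŝᵢ × R = w₀ m̂ᵢ - tᵢ⁰ ŵ`. If `r₀` lies on the line through the side, then `ŝᵢ × R = 0` and the
side contributes nothing.
-/

section Triangle

/-- The standard closed triangle in the plane, over which a flat triangle is parametrised by
`planeChart`. -/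
def stdTriangle : Set (ℝ × ℝ) := {z | 0 ≤ z.1 ∧ 0 ≤ z.2 ∧ z.1 + z.2 ≤ 1}

theorem mem_stdTriangle_iff_fst {x y : ℝ} :
    (x, y) ∈ stdTriangle ↔ y ∈ Set.Icc (0 : ℝ) 1 ∧ x ∈ Set.Icc 0 (1 - y) := by
  simp only [stdTriangle, Set.mem_ofPred_eq, Set.mem_Icc]
  grind

theorem isCompact_stdTriangle : IsCompact stdTriangle := by
  have hclosed : IsClosed stdTriangle :=
    (isClosed_le continuous_const continuous_fst).inter
      ((isClosed_le continuous_const continuous_snd).inter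
        (isClosed_le (continuous_fst.add continuous_snd) continuous_const))
  refine (isCompact_Icc (a := ((0, 0) : ℝ × ℝ)) (b := (1, 1))).of_isClosed_subset hclosed ?_
  rintro ⟨x, y⟩ ⟨hx, hy, hxy⟩
  dsimp only at hx hy hxy
  exact ⟨⟨hx, hy⟩, ⟨by linarith, by linarith⟩⟩

theorem stdTriangle_eq_convexHull :
    stdTriangle = convexHull ℝ {((0, 0) : ℝ × ℝ), (1, 0), (0, 1)} := by
  apply Set.Subset.antisymm
  · rintro ⟨x, y⟩ ⟨hx, hy, hxy⟩
    dsimp only at hx hy hxy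
    have hsum := (convex_convexHull ℝ {((0, 0) : ℝ × ℝ), (1, 0), (0, 1)}).sum_mem
      (t := Finset.univ) (w := ![1 - x - y, x, y]) (z := ![(0, 0), (1, 0), (0, 1)])
      (by simpa [Fin.forall_fin_succ, hx, hy] using by linarith)
      (by rw [Fin.sum_univ_three]; simp only [Matrix.cons_val]; ring)
      (fun i _ => subset_convexHull ℝ _ (by fin_cases i <;> simp))
    simpa [Fin.sum_univ_three] using hsum
  · refine convexHull_min (by simp [Set.insert_subset_iff, stdTriangle]) ?_
    rintro ⟨x, y⟩ ⟨hx, hy, hxy⟩ ⟨x', y'⟩ ⟨hx', hy', hxy'⟩ a b ha hb hab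
    dsimp only at hx hy hxy hx' hy' hxy'
    refine ⟨?_, ?_, ?_⟩ <;> simp only [Prod.smul_mk, smul_eq_mul, Prod.mk_add_mk] <;>
      first | positivity | nlinarith

variable {F : Type*} [NormedAddCommGroup F] [NormedSpace ℝ F]

theorem setIntegral_stdTriangle {f : ℝ × ℝ → F} (hf : ContinuousOn f stdTriangle) :
    ∫ z in stdTriangle, f z = ∫ y in (0 : ℝ)..1, ∫ x in (0 : ℝ)..(1 - y), f (x, y) := by
  have hS : MeasurableSet stdTriangle := isCompact_stdTriangle.measurableSet
  have hint : Integrable (stdTriangle.indicator f) :=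
    (integrable_indicator_iff hS).2 (hf.integrableOn_compact isCompact_stdTriangle)
  rw [← integral_indicator hS, Measure.volume_eq_prod, integral_prod_symm _ hint,
    intervalIntegral.integral_of_le zero_le_one, ← integral_Icc_eq_integral_Ioc,
    ← integral_indicator measurableSet_Icc]
  congr 1 with y
  by_cases hy : y ∈ Set.Icc (0 : ℝ) 1
  · have hslice : (fun x => stdTriangle.indicator f (x, y)) =
        (Set.Icc (0 : ℝ) (1 - y)).indicator (fun x => f (x, y)) := by
      ext x
      simp only [Set.indicator, mem_stdTriangle_iff_fst, hy, true_and]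
    rw [Set.indicator_of_mem hy, hslice, integral_indicator measurableSet_Icc,
      integral_Icc_eq_integral_Ioc, ← intervalIntegral.integral_of_le (sub_nonneg.2 hy.2)]
  · simp only [Set.indicator, mem_stdTriangle_iff_fst, hy, false_and, if_false, integral_zero]

variable [CompleteSpace F]

theorem setIntegral_stdTriangle_of_hasDerivAt_fst {G f : ℝ × ℝ → F}
    (hf : ContinuousOn f stdTriangle)
    (hG : ∀ z ∈ stdTriangle, HasDerivAt (fun x => G (x, z.2)) (f z) z.1) :
    ∫ z in stdTriangle, f z = ∫ y in (0 : ℝ)..1, (G (1 - y, y) - G (0, y)) := by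
  rw [setIntegral_stdTriangle hf]
  refine intervalIntegral.integral_congr fun y hy => ?_
  rw [Set.uIcc_of_le zero_le_one] at hy
  have hslice : ∀ x ∈ Set.uIcc 0 (1 - y), (x, y) ∈ stdTriangle := fun x hx =>
    mem_stdTriangle_iff_fst.2 ⟨hy, by rwa [Set.uIcc_of_le (sub_nonneg.2 hy.2)] at hx⟩
  exact intervalIntegral.integral_eq_sub_of_hasDerivAt (f := fun x => G (x, y))
    (fun x hx => hG _ (hslice x hx))
    (hf.comp (Continuous.prodMk_left y).continuousOn hslice).intervalIntegrable

theorem setIntegral_stdTriangle_of_hasDerivAt_snd {G f : ℝ × ℝ → F}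
    (hf : ContinuousOn f stdTriangle)
    (hG : ∀ z ∈ stdTriangle, HasDerivAt (fun y => G (z.1, y)) (f z) z.2) :
    ∫ z in stdTriangle, f z = ∫ x in (0 : ℝ)..1, (G (x, 1 - x) - G (x, 0)) := by
  have hswap : Prod.swap ⁻¹' stdTriangle = stdTriangle := by
    ext ⟨x, y⟩
    simp only [stdTriangle, Set.mem_preimage, Prod.swap, Set.mem_ofPred_eq, add_comm y x]
    tauto
  have hmp : MeasurePreserving (Prod.swap : ℝ × ℝ → ℝ × ℝ) volume volume :=
    Measure.measurePreserving_swap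
  rw [← hmp.setIntegral_preimage_emb MeasurableEquiv.prodComm.measurableEmbedding, hswap]
  exact setIntegral_stdTriangle_of_hasDerivAt_fst (G := G ∘ Prod.swap) (f := f ∘ Prod.swap)
    (hf.comp continuous_swap.continuousOn hswap.ge) (fun z hz => hG z.swap (hswap.ge hz))

end Triangle

section Chart

variable {E : Type*}

/-- The affine parametrisation of a plane by a base point `o` and two spanning vectors. -/
def planeChart [AddCommGroup E] [Module ℝ E] (o e₁ e₂ : E) : ℝ × ℝ →ᵃ[ℝ] E :=
  ((LinearMap.toSpanSingleton ℝ E e₁).coprod (LinearMap.toSpanSingleton ℝ E e₂)).toAffineMap +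
    AffineMap.const ℝ (ℝ × ℝ) o

theorem planeChart_apply [AddCommGroup E] [Module ℝ E] (o e₁ e₂ : E) (z : ℝ × ℝ) :
    planeChart o e₁ e₂ z = z.1 • e₁ + z.2 • e₂ + o := rfl

theorem planeChart_image_stdTriangle [AddCommGroup E] [Module ℝ E] (a b c : E) :
    planeChart a (b - a) (c - a) '' stdTriangle = convexHull ℝ {a, b, c} := by
  rw [stdTriangle_eq_convexHull, AffineMap.image_convexHull, Set.image_insert_eq, Set.image_pair]
  simp [planeChart_apply]

theorem injective_planeChart [AddCommGroup E] [Module ℝ E] {o e₁ e₂ : E}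
    (h : LinearIndependent ℝ ![e₁, e₂]) : Function.Injective (planeChart o e₁ e₂) := by
  intro z z' hz
  simp only [planeChart_apply, add_left_inj] at hz
  obtain ⟨hfst, hsnd⟩ := LinearIndependent.pair_iff.1 h (z.1 - z'.1) (z.2 - z'.2) (by
    rw [sub_smul, sub_smul, sub_add_sub_comm, hz, sub_self])
  exact Prod.ext (sub_eq_zero.1 hfst) (sub_eq_zero.1 hsnd)

variable [NormedAddCommGroup E] [NormedSpace ℝ E]

theorem continuous_planeChart (o e₁ e₂ : E) : Continuous (planeChart o e₁ e₂) := by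
  change Continuous fun z : ℝ × ℝ => z.1 • e₁ + z.2 • e₂ + o
  fun_prop

theorem hasDerivAt_planeChart_fst (o e₁ e₂ : E) (x y : ℝ) :
    HasDerivAt (fun x => planeChart o e₁ e₂ (x, y)) e₁ x := by
  simpa [planeChart_apply, add_assoc] using
    ((hasDerivAt_id x).smul_const e₁).add_const (y • e₂ + o)

theorem hasDerivAt_planeChart_snd (o e₁ e₂ : E) (x y : ℝ) :
    HasDerivAt (fun y => planeChart o e₁ e₂ (x, y)) e₂ y := by
  simpa [planeChart_apply] using
    (((hasDerivAt_id y).smul_const e₂).const_add (x • e₁)).add_const o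

theorem planeChart_mk_zero (a b c : E) (t : ℝ) :
    planeChart a (b - a) (c - a) (t, 0) = AffineMap.lineMap a b t := by
  simp [planeChart_apply, AffineMap.lineMap_apply]

theorem planeChart_zero_mk (a b c : E) (t : ℝ) :
    planeChart a (b - a) (c - a) (0, t) = AffineMap.lineMap a c t := by
  simp [planeChart_apply, AffineMap.lineMap_apply]

theorem planeChart_one_sub_mk (a b c : E) (t : ℝ) :
    planeChart a (b - a) (c - a) (1 - t, t) = AffineMap.lineMap b c t := by
  simp only [planeChart_apply, AffineMap.lineMap_apply, vsub_eq_sub, vadd_eq_add]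
  module

theorem planeChart_mk_one_sub (a b c : E) (t : ℝ) :
    planeChart a (b - a) (c - a) (t, 1 - t) = AffineMap.lineMap c b t := by
  simp only [planeChart_apply, AffineMap.lineMap_apply, vsub_eq_sub, vadd_eq_add]
  module

variable {F : Type*} [NormedAddCommGroup F]

theorem intervalIntegrable_comp_lineMap {f : E → F} {s : Set E} {a b : E} (hf : ContinuousOn f s)
    (hs : Convex ℝ s) (ha : a ∈ s) (hb : b ∈ s) :
    IntervalIntegrable (fun t => f (AffineMap.lineMap a b t)) volume 0 1 :=
  (hf.comp AffineMap.lineMap_continuous.continuousOn fun _ ht =>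
    hs.lineMap_mem ha hb ht).intervalIntegrable_of_Icc zero_le_one

theorem integral_comp_lineMap_symm [NormedSpace ℝ F] (f : E → F) (a b : E) :
    ∫ t in (0 : ℝ)..1, f (AffineMap.lineMap b a t) =
      ∫ t in (0 : ℝ)..1, f (AffineMap.lineMap a b t) := by
  simpa [AffineMap.lineMap_apply_one_sub] using
    intervalIntegral.integral_comp_sub_left (fun t => f (AffineMap.lineMap a b t)) (1 : ℝ)
      (a := 0) (b := 1)

variable [NormedSpace ℝ F]

theorem hasDerivAt_comp_apply {ω : E → E →L[ℝ] F} {ω' : E →L[ℝ] E →L[ℝ] F} {γ : ℝ → E} {γ' : E}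
    {t : ℝ} (hω : HasFDerivAt ω ω' (γ t)) (hγ : HasDerivAt γ γ' t) (v : E) :
    HasDerivAt (fun s => ω (γ s) v) (ω' γ' v) t := by
  simpa using (hω.comp_hasDerivAt t hγ).clm_apply (hasDerivAt_const t v)

theorem setIntegral_stdTriangle_curl [CompleteSpace F] {ω : E → E →L[ℝ] F}
    {ω' : E → E →L[ℝ] E →L[ℝ] F} {a b c : E}
    (hω : ∀ x ∈ convexHull ℝ {a, b, c}, HasFDerivAt ω (ω' x) x)
    (hω' : ContinuousOn ω' (convexHull ℝ {a, b, c})) :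
    ∫ z in stdTriangle, (ω' (planeChart a (b - a) (c - a) z) (b - a) (c - a) -
        ω' (planeChart a (b - a) (c - a) z) (c - a) (b - a)) =
      (∫ᶜ x in .segment a b, ω x) + (∫ᶜ x in .segment b c, ω x) + ∫ᶜ x in .segment c a, ω x := by
  set Φ := planeChart a (b - a) (c - a)
  have hmem : ∀ z ∈ stdTriangle, Φ z ∈ convexHull ℝ {a, b, c} := fun z hz =>
    planeChart_image_stdTriangle a b c ▸ Set.mem_image_of_mem Φ hz
  have hcont (u v : E) : ContinuousOn (fun z => ω' (Φ z) u v) stdTriangle :=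
    ((hω'.comp (continuous_planeChart ..).continuousOn hmem).clm_apply
      continuousOn_const).clm_apply continuousOn_const
  have hfst := setIntegral_stdTriangle_of_hasDerivAt_fst (G := fun z => ω (Φ z) (c - a))
    (hcont (b - a) (c - a)) fun z hz =>
      hasDerivAt_comp_apply (hω _ (hmem z hz)) (hasDerivAt_planeChart_fst ..) (c - a)
  have hsnd := setIntegral_stdTriangle_of_hasDerivAt_snd (G := fun z => ω (Φ z) (b - a))
    (hcont (c - a) (b - a)) fun z hz =>
      hasDerivAt_comp_apply (hω _ (hmem z hz)) (hasDerivAt_planeChart_snd ..) (b - a)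
  have hside {u v : E} (hu : u ∈ ({a, b, c} : Set E)) (hv : v ∈ ({a, b, c} : Set E)) (w : E) :
      IntervalIntegrable (fun t => ω (AffineMap.lineMap u v t) w) volume 0 1 :=
    intervalIntegrable_comp_lineMap (f := fun x => ω x w)
      (fun x hx => ((hω x hx).continuousAt.clm_apply continuousAt_const).continuousWithinAt)
      (convex_convexHull ℝ _) (subset_convexHull ℝ _ hu) (subset_convexHull ℝ _ hv)
  simp only [Φ, planeChart_one_sub_mk, planeChart_zero_mk] at hfst
  simp only [Φ, planeChart_mk_one_sub, planeChart_mk_zero] at hsnd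
  rw [intervalIntegral.integral_sub (hside (by simp) (by simp) _) (hside (by simp) (by simp) _)]
    at hfst hsnd
  rw [integral_sub ((hcont _ _).integrableOn_compact isCompact_stdTriangle)
    ((hcont _ _).integrableOn_compact isCompact_stdTriangle), hfst, hsnd,
    integral_comp_lineMap_symm (fun x => ω x (b - a)) b c, ← Path.segment_symm a c,
    curveIntegral_symm]
  have hbc : ∫ t in (0 : ℝ)..1, ω (AffineMap.lineMap b c t) (c - b) =
      (∫ t in (0 : ℝ)..1, ω (AffineMap.lineMap b c t) (c - a)) -
        ∫ t in (0 : ℝ)..1, ω (AffineMap.lineMap b c t) (b - a) := by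
    rw [← intervalIntegral.integral_sub (hside (by simp) (by simp) _)
      (hside (by simp) (by simp) _)]
    simp only [← map_sub, sub_sub_sub_cancel_right]
  simp only [curveIntegral_segment, hbc]
  abel

end Chart

section Area

variable {V : Type*} [NormedAddCommGroup V] [InnerProductSpace ℝ V]

/-- The area of the parallelogram spanned by two vectors, as the square root of their Gram
determinant; it is the Jacobian of `planeChart`. -/
noncomputable def parallelogramArea (e₁ e₂ : V) : ℝ :=
  √(‖e₁‖ ^ 2 * ‖e₂‖ ^ 2 - ⟪e₁, e₂⟫_ℝ ^ 2)

theorem parallelogramArea_nonneg (e₁ e₂ : V) : 0 ≤ parallelogramArea e₁ e₂ := Real.sqrt_nonneg _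

variable [MeasurableSpace V] [BorelSpace V]

theorem measurableEmbedding_planeChart {o e₁ e₂ : V} (h : LinearIndependent ℝ ![e₁, e₂]) :
    MeasurableEmbedding (planeChart o e₁ e₂) :=
  (continuous_planeChart o e₁ e₂).measurableEmbedding (injective_planeChart h)

theorem euclideanHausdorffMeasure_planeChart_image (o e₁ e₂ : V) (A : Set (ℝ × ℝ)) :
    μHE[2] (planeChart o e₁ e₂ '' A) = ENNReal.ofReal (parallelogramArea e₁ e₂) * volume A := by
  let coords : EuclideanSpace ℝ (Fin 2) ≃ᵐ ℝ × ℝ :=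
    (MeasurableEquiv.toLp 2 (Fin 2 → ℝ)).symm.trans MeasurableEquiv.finTwoArrow
  have hcoords : MeasurePreserving coords :=
    (volume_preserving_finTwoArrow ℝ).comp (PiLp.volume_preserving_ofLp (Fin 2))
  let L : EuclideanSpace ℝ (Fin 2) →ₗ[ℝ] V :=
    (LinearMap.toSpanSingleton ℝ V e₁).coprod (LinearMap.toSpanSingleton ℝ V e₂) ∘ₗ
      (LinearEquiv.finTwoArrow ℝ ℝ).toLinearMap ∘ₗ
      (WithLp.linearEquiv 2 ℝ (Fin 2 → ℝ)).toLinearMap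
  have hL (z) : L z = z 0 • e₁ + z 1 • e₂ := rfl
  have hchart (z) : planeChart o e₁ e₂ (coords z) = IsometryEquiv.addRight o (L z) := rfl
  have hdet : L.normDet = parallelogramArea e₁ e₂ := by
    have hgram := L.normDet_sq_eq_det_gram (EuclideanSpace.basisFun (Fin 2) ℝ)
    simp only [Matrix.det_fin_two, Matrix.gram, hL] at hgram
    rw [parallelogramArea, ← Real.sqrt_sq L.normDet_nonneg]
    simpa [real_inner_comm e₁ e₂, ← pow_two] using congrArg Real.sqrt hgram
  have himage : planeChart o e₁ e₂ '' A = IsometryEquiv.addRight o '' (L '' (coords ⁻¹' A)) := by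
    simp only [Set.image_image, ← hchart]
    rw [← Set.image_image (planeChart o e₁ e₂) coords, Set.image_preimage_eq A coords.surjective]
  have hvolume := L.euclideanHausdorffMeasure_image_eq_normDet_mul_volume (coords ⁻¹' A)
  rw [finrank_euclideanSpace_fin, hdet, hcoords.measure_preimage_equiv] at hvolume
  rw [himage, (IsometryEquiv.addRight o).isometry.euclideanHausdorffMeasure_image, hvolume]

theorem map_planeChart_restrict {o e₁ e₂ : V} (h : LinearIndependent ℝ ![e₁, e₂])
    (S : Set (ℝ × ℝ)) :
    (ENNReal.ofReal (parallelogramArea e₁ e₂) • volume.restrict S).map (planeChart o e₁ e₂) =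
      μHE[2].restrict (planeChart o e₁ e₂ '' S) := by
  have hemb : MeasurableEmbedding (planeChart o e₁ e₂) := measurableEmbedding_planeChart h
  ext A hA
  rw [hemb.map_apply, Measure.smul_apply, Measure.restrict_apply (hemb.measurable hA),
    Measure.restrict_apply hA, smul_eq_mul, ← euclideanHausdorffMeasure_planeChart_image o,
    Set.image_preimage_inter]

theorem setIntegral_planeChart_image {F : Type*} [NormedAddCommGroup F] [NormedSpace ℝ F]
    {o e₁ e₂ : V} (h : LinearIndependent ℝ ![e₁, e₂]) (S : Set (ℝ × ℝ)) (f : V → F) :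
    ∫ r in planeChart o e₁ e₂ '' S, f r ∂μHE[2] =
      parallelogramArea e₁ e₂ • ∫ z in S, f (planeChart o e₁ e₂ z) := by
  rw [← map_planeChart_restrict h, (measurableEmbedding_planeChart h).integral_map,
    integral_smul_measure, ENNReal.toReal_ofReal (parallelogramArea_nonneg _ _)]

theorem integrableOn_planeChart_image {F : Type*} [NormedAddCommGroup F]
    {o e₁ e₂ : V} (h : LinearIndependent ℝ ![e₁, e₂]) {S : Set (ℝ × ℝ)} {f : V → F}
    (hf : IntegrableOn (fun z => f (planeChart o e₁ e₂ z)) S) :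
    IntegrableOn f (planeChart o e₁ e₂ '' S) μHE[2] := by
  rw [IntegrableOn, ← map_planeChart_restrict h,
    (measurableEmbedding_planeChart h).integrable_map_iff]
  exact Integrable.smul_measure hf ENNReal.ofReal_ne_top

end Area

section Calculus

variable {V : Type*} [NormedAddCommGroup V] [InnerProductSpace ℝ V]

theorem hasFDerivAt_norm_sub {r₀ r : V} (hr : r ≠ r₀) :
    HasFDerivAt (fun r => ‖r - r₀‖) (‖r - r₀‖⁻¹ • innerSL ℝ (r - r₀)) r := by
  have hne : ‖r - r₀‖ ≠ 0 := norm_ne_zero_iff.2 (sub_ne_zero.2 hr)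
  have hsqrt := (((hasFDerivAt_id r).sub_const r₀).norm_sq).sqrt (pow_ne_zero 2 hne)
  simp only [id, Real.sqrt_sq (norm_nonneg _)] at hsqrt
  refine hsqrt.congr_fderiv ?_
  ext h
  simp only [one_div, mul_inv_rev, map_sub, ContinuousLinearMap.comp_id, smul_apply, sub_apply,
    coe_innerSL_apply, nsmul_eq_mul, Nat.cast_ofNat, smul_eq_mul]
  field_simp

theorem hasFDerivAt_inv_norm_sub_pow {r₀ r : V} (hr : r ≠ r₀) (n : ℕ) :
    HasFDerivAt (fun r => (‖r - r₀‖ ^ n)⁻¹)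
      (-(n * (‖r - r₀‖ ^ (n + 2))⁻¹) • innerSL ℝ (r - r₀)) r := by
  have hne : ‖r - r₀‖ ≠ 0 := norm_ne_zero_iff.2 (sub_ne_zero.2 hr)
  refine (((hasDerivAt_pow n ‖r - r₀‖).fun_inv (pow_ne_zero n hne)).comp_hasFDerivAt r
    (hasFDerivAt_norm_sub hr)).congr_fderiv ?_
  rw [smul_smul]
  congr 1
  rcases n with _ | n
  · simp
  · simp only [Nat.cast_add, Nat.cast_one, add_tsub_cancel_right]
    field_simp
    ring

theorem hasFDerivAt_inv_norm_sub_pow_smul {F : Type*} [NormedAddCommGroup F] [NormedSpace ℝ F]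
    {r₀ r : V} (hr : r ≠ r₀) (n : ℕ) (L : V →L[ℝ] F) :
    HasFDerivAt (fun r => (‖r - r₀‖ ^ n)⁻¹ • L (r - r₀))
      ((‖r - r₀‖ ^ n)⁻¹ • L -
        (n * (‖r - r₀‖ ^ (n + 2))⁻¹) • (innerSL ℝ (r - r₀)).smulRight (L (r - r₀))) r := by
  refine ((hasFDerivAt_inv_norm_sub_pow hr n).smul
    (L.hasFDerivAt.comp r ((hasFDerivAt_id r).sub_const r₀))).congr_fderiv ?_
  ext h
  simp only [add_apply, sub_apply, smul_apply, ContinuousLinearMap.smulRight_apply,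
    ContinuousLinearMap.comp_apply, ContinuousLinearMap.id_apply, Function.comp_apply, id]
  module

theorem integral_inv_norm_add_smul_pow_three {x d : V} (h : ‖x‖ ^ 2 * ‖d‖ ^ 2 - ⟪x, d⟫_ℝ ^ 2 ≠ 0) :
    ∫ s in (0 : ℝ)..1, (‖x + s • d‖ ^ 3)⁻¹ =
      (⟪x + d, d⟫_ℝ / ‖x + d‖ - ⟪x, d⟫_ℝ / ‖x‖) / (‖x‖ ^ 2 * ‖d‖ ^ 2 - ⟪x, d⟫_ℝ ^ 2) := by
  have hgram (s : ℝ) : ‖x + s • d‖ ^ 2 * ‖d‖ ^ 2 - ⟪x + s • d, d⟫_ℝ ^ 2 =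
      ‖x‖ ^ 2 * ‖d‖ ^ 2 - ⟪x, d⟫_ℝ ^ 2 := by
    rw [norm_add_sq_real, norm_smul, inner_add_left, real_inner_smul_left, real_inner_smul_right,
      real_inner_self_eq_norm_sq, Real.norm_eq_abs, mul_pow, sq_abs]
    ring
  have hne (s : ℝ) : x + s • d ≠ 0 := fun hs => h (by simpa [hs] using (hgram s).symm)
  have hderiv (s : ℝ) : HasDerivAt
      (fun s => ⟪x + s • d, d⟫_ℝ * (‖x + s • d‖ ^ 1)⁻¹ / (‖x‖ ^ 2 * ‖d‖ ^ 2 - ⟪x, d⟫_ℝ ^ 2))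
      (‖x + s • d‖ ^ 3)⁻¹ s := by
    have hline : HasDerivAt (fun s : ℝ => x + s • d) d s := by
      simpa using ((hasDerivAt_id s).smul_const d).const_add x
    have hinv := (hasFDerivAt_inv_norm_sub_pow (r₀ := 0) (hne s) 1).comp_hasDerivAt s hline
    simp only [sub_zero, Function.comp_def] at hinv
    have hinner := hline.inner ℝ (hasDerivAt_const s d)
    refine ((hinner.mul hinv).div_const _).congr_deriv ?_
    have hnorm := norm_ne_zero_iff.2 (hne s)
    rw [div_eq_iff h, ← hgram s]
    simp only [innerSL_apply_apply, smul_apply, inner_zero_right, zero_add,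
      real_inner_self_eq_norm_sq, smul_eq_mul, Nat.cast_one]
    field_simp
    ring
  rw [intervalIntegral.integral_eq_sub_of_hasDerivAt (fun s _ => hderiv s)]
  · simp [div_eq_mul_inv, sub_mul]
  · refine Continuous.intervalIntegrable (Continuous.inv₀ (by fun_prop) fun s => ?_) _ _
    exact pow_ne_zero 3 (norm_ne_zero_iff.2 (hne s))

end Calculus

section CrossProduct

theorem inner_E3 (a b : E3) : ⟪a, b⟫_ℝ = a 0 * b 0 + a 1 * b 1 + a 2 * b 2 := by
  simp [PiLp.inner_apply, Fin.sum_univ_three, mul_comm]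

theorem cross3_apply_zero (a b : E3) : cross3 a b 0 = a 1 * b 2 - a 2 * b 1 := by
  simp [cross3, cross_apply]

theorem cross3_apply_one (a b : E3) : cross3 a b 1 = a 2 * b 0 - a 0 * b 2 := by
  simp [cross3, cross_apply]

theorem cross3_apply_two (a b : E3) : cross3 a b 2 = a 0 * b 1 - a 1 * b 0 := by
  simp [cross3, cross_apply]

theorem cross3_add_left (a b c : E3) : cross3 (a + b) c = cross3 a c + cross3 b c := by
  simp [cross3]

theorem cross3_smul_left (t : ℝ) (a b : E3) : cross3 (t • a) b = t • cross3 a b := by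
  simp [cross3]

theorem cross3_smul_right (t : ℝ) (a b : E3) : cross3 a (t • b) = t • cross3 a b := by
  simp [cross3]

theorem cross3_sub_left (a b c : E3) : cross3 (a - b) c = cross3 a c - cross3 b c := by
  simp [cross3]

theorem cross3_sub_right (a b c : E3) : cross3 a (b - c) = cross3 a b - cross3 a c := by
  simp [cross3]

theorem cross3_self (a : E3) : cross3 a a = 0 := by
  simp [cross3]

theorem cross3_anticomm (a b : E3) : cross3 a b = -cross3 b a := by
  rw [cross3, ← cross_anticomm, WithLp.toLp_neg]; rfl

theorem inner_self_cross3 (a b : E3) : ⟪a, cross3 a b⟫_ℝ = 0 := by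
  rw [inner_E3, cross3_apply_zero, cross3_apply_one, cross3_apply_two]; ring

theorem inner_cross3_self (a b : E3) : ⟪b, cross3 a b⟫_ℝ = 0 := by
  rw [inner_E3, cross3_apply_zero, cross3_apply_one, cross3_apply_two]; ring

theorem inner_cross3_left (a b c : E3) : ⟪cross3 a b, c⟫_ℝ = ⟪a, cross3 b c⟫_ℝ := by
  simp only [inner_E3, cross3_apply_zero, cross3_apply_one, cross3_apply_two]; ring

theorem inner_cross3_cross3 (a b c d : E3) :
    ⟪cross3 a b, cross3 c d⟫_ℝ = ⟪a, c⟫_ℝ * ⟪b, d⟫_ℝ - ⟪a, d⟫_ℝ * ⟪b, c⟫_ℝ := by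
  simp only [inner_E3, cross3_apply_zero, cross3_apply_one, cross3_apply_two]; ring

theorem cross3_cross3_left (a b c : E3) :
    cross3 (cross3 a b) c = ⟪a, c⟫_ℝ • b - ⟪b, c⟫_ℝ • a := by
  ext i
  fin_cases i <;>
    simp only [Fin.zero_eta, Fin.mk_one, Fin.reduceFinMk, inner_E3, cross3_apply_zero,
      cross3_apply_one, cross3_apply_two, PiLp.sub_apply, PiLp.smul_apply, smul_eq_mul] <;>
    ring

theorem cross3_cross3_right (a b c : E3) :
    cross3 a (cross3 b c) = ⟪a, c⟫_ℝ • b - ⟪a, b⟫_ℝ • c := by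
  rw [cross3_anticomm, cross3_cross3_left, neg_sub, real_inner_comm a c, real_inner_comm a b]

theorem norm_cross3_sq (a b : E3) : ‖cross3 a b‖ ^ 2 = ‖a‖ ^ 2 * ‖b‖ ^ 2 - ⟪a, b⟫_ℝ ^ 2 := by
  rw [← real_inner_self_eq_norm_sq, inner_cross3_cross3, real_inner_self_eq_norm_sq,
    real_inner_self_eq_norm_sq, real_inner_comm a b, pow_two ⟪a, b⟫_ℝ]

theorem norm_eq_sqrt_inner_sq_add_norm_cross3_sq {e : E3} (he : ‖e‖ = 1) (x : E3) :
    ‖x‖ = √(⟪x, e⟫_ℝ ^ 2 + ‖cross3 e x‖ ^ 2) := by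
  rw [norm_cross3_sq, he, one_pow, one_mul, real_inner_comm, add_sub_cancel,
    Real.sqrt_sq (norm_nonneg _)]

theorem parallelogramArea_eq_norm_cross3 (a b : E3) : parallelogramArea a b = ‖cross3 a b‖ := by
  rw [parallelogramArea, ← norm_cross3_sq, Real.sqrt_sq (norm_nonneg _)]

theorem cross3_ne_zero {a b : E3} (h : LinearIndependent ℝ ![a, b]) : cross3 a b ≠ 0 := by
  have hli : LinearIndependent ℝ ![a.ofLp, b.ofLp] := by
    rw [LinearIndependent.pair_iff] at h ⊢
    exact fun s t hst => h s t (WithLp.ofLp_injective 2 hst)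
  simpa [cross3] using crossProduct_ne_zero_iff_linearIndependent.2 hli

theorem cross3_eq_of_unit_normal {e w : E3} (hw : ‖w‖ = 1) (hew : ⟪e, w⟫_ℝ = 0) (x : E3) :
    cross3 e x = ⟪x, w⟫_ℝ • cross3 e w - ⟪x, cross3 e w⟫_ℝ • w := by
  have hframe : cross3 w (cross3 e w) = e := by
    rw [cross3_cross3_right, real_inner_self_eq_norm_sq, hw, real_inner_comm, hew]
    simp
  rw [real_inner_comm _ x, real_inner_comm _ x, ← cross3_cross3_left, hframe]

variable {u w : E3}

theorem cross3_unit_normal (hu : ‖u‖ = 1) (huw : ⟪u, w⟫_ℝ = 0) (a : E3) :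
    cross3 a w = ⟪a, cross3 w u⟫_ℝ • u - ⟪a, u⟫_ℝ • cross3 w u := by
  have hframe : cross3 u (cross3 w u) = w := by
    rw [cross3_cross3_right, real_inner_self_eq_norm_sq, hu, huw]
    simp
  rw [← cross3_cross3_right, hframe]

theorem inner_eq_of_inner_unit_normal_eq_zero (hu : ‖u‖ = 1) (hw : ‖w‖ = 1) (huw : ⟪u, w⟫_ℝ = 0)
    (a : E3) {b : E3} (hb : ⟪b, w⟫_ℝ = 0) :
    ⟪a, b⟫_ℝ = ⟪a, u⟫_ℝ * ⟪b, u⟫_ℝ + ⟪a, cross3 w u⟫_ℝ * ⟪b, cross3 w u⟫_ℝ := by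
  have hrotate : ⟪cross3 a w, cross3 b w⟫_ℝ = ⟪a, b⟫_ℝ := by
    rw [inner_cross3_cross3, real_inner_self_eq_norm_sq, hw, real_inner_comm b w, hb]
    ring
  rw [← hrotate, cross3_unit_normal hu huw b, inner_sub_right, real_inner_smul_right,
    real_inner_smul_right, inner_cross3_left, inner_cross3_left, cross3_cross3_right,
    inner_sub_right, real_inner_smul_right, real_inner_smul_right, real_inner_self_eq_norm_sq, hw,
    real_inner_comm u w, huw]
  ring

end CrossProduct

section Dipole

theorem hasGradientAt_dipoleKernel (q : E3) {r₀ r : E3} (hr : r ≠ r₀) :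
    HasGradientAt (dipoleKernel q r₀)
      ((‖r - r₀‖ ^ 3)⁻¹ • q - (3 * (‖r - r₀‖ ^ 5)⁻¹ * ⟪q, r - r₀⟫_ℝ) • (r - r₀)) r := by
  have hkernel : dipoleKernel q r₀ = fun r => (‖r - r₀‖ ^ 3)⁻¹ • innerSL ℝ q (r - r₀) := by
    ext r
    rw [dipoleKernel, div_eq_inv_mul]
    rfl
  rw [hasGradientAt_iff_hasFDerivAt, hkernel]
  refine (hasFDerivAt_inv_norm_sub_pow_smul hr 3 (innerSL ℝ q)).congr_fderiv ?_
  ext h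
  simp only [sub_apply, smul_apply, ContinuousLinearMap.smulRight_apply, coe_innerSL_apply,
    InnerProductSpace.toDual_apply_apply, inner_sub_left, real_inner_smul_left, smul_eq_mul,
    Nat.cast_ofNat]
  ring

theorem inner_gradient_dipoleKernel (q w : E3) {r₀ r : E3} (hr : r ≠ r₀) :
    ⟪w, gradient (dipoleKernel q r₀) r⟫_ℝ = (‖r - r₀‖ ^ 3)⁻¹ * ⟪w, q⟫_ℝ -
      3 * (‖r - r₀‖ ^ 5)⁻¹ * ⟪q, r - r₀⟫_ℝ * ⟪w, r - r₀⟫_ℝ := by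
  rw [(hasGradientAt_dipoleKernel q hr).gradient, inner_sub_right (𝕜 := ℝ), real_inner_smul_right,
    real_inner_smul_right]

theorem continuousAt_inner_gradient_dipoleKernel (q w : E3) {r₀ r : E3} (hr : r ≠ r₀) :
    ContinuousAt (fun r => ⟪w, gradient (dipoleKernel q r₀) r⟫_ℝ) r := by
  have hne : ‖r - r₀‖ ≠ 0 := norm_ne_zero_iff.2 (sub_ne_zero.2 hr)
  refine ContinuousAt.congr_of_eventuallyEq ?_ ((isOpen_ne.eventually_mem hr).mono fun r' hr' =>
    inner_gradient_dipoleKernel q w hr')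
  fun_prop (disch := positivity)

/-- The cross product by a fixed left factor, as a continuous linear map. -/
noncomputable def cross3Left (q : E3) : E3 →L[ℝ] E3 :=
  LinearMap.toContinuousLinearMap <| (WithLp.linearEquiv 2 ℝ (Fin 3 → ℝ)).symm.toLinearMap ∘ₗ
    crossProduct q.ofLp ∘ₗ (WithLp.linearEquiv 2 ℝ (Fin 3 → ℝ)).toLinearMap

/-- The vector potential `q × R / R³` of the dipole field, where `R = r - r₀`, encoded as the
1-form `v ↦ ⟪q × R, v⟫ / R³` so that its circulation is a curve integral. -/
noncomputable def dipolePotential (q r₀ r : E3) : E3 →L[ℝ] ℝ :=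
  (‖r - r₀‖ ^ 3)⁻¹ • ((innerSL ℝ : E3 →L[ℝ] E3 →L[ℝ] ℝ) ∘L cross3Left q) (r - r₀)

theorem dipolePotential_apply (q r₀ r v : E3) :
    dipolePotential q r₀ r v = (‖r - r₀‖ ^ 3)⁻¹ * ⟪cross3 q (r - r₀), v⟫_ℝ := rfl

theorem contDiffAt_dipolePotential (q : E3) {r₀ r : E3} (hr : r ≠ r₀) :
    ContDiffAt ℝ 1 (dipolePotential q r₀) r := by
  have hne := sub_ne_zero.2 hr
  unfold dipolePotential
  exact ((((contDiffAt_id.sub contDiffAt_const).norm ℝ hne).pow 3).inv (by simpa using hne)).smul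
    (by fun_prop)

theorem fderiv_dipolePotential_apply (q : E3) {r₀ r : E3} (hr : r ≠ r₀) (u v : E3) :
    fderiv ℝ (dipolePotential q r₀) r u v = (‖r - r₀‖ ^ 3)⁻¹ * ⟪cross3 q u, v⟫_ℝ -
      3 * (‖r - r₀‖ ^ 5)⁻¹ * ⟪r - r₀, u⟫_ℝ * ⟪cross3 q (r - r₀), v⟫_ℝ := by
  have hderiv : HasFDerivAt (dipolePotential q r₀) _ r :=
    hasFDerivAt_inv_norm_sub_pow_smul hr 3 ((innerSL ℝ : E3 →L[ℝ] E3 →L[ℝ] ℝ) ∘L cross3Left q)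
  rw [hderiv.fderiv]
  change (‖r - r₀‖ ^ 3)⁻¹ * ⟪cross3 q u, v⟫_ℝ - ((3 : ℕ) * (‖r - r₀‖ ^ (3 + 2))⁻¹) *
    (⟪r - r₀, u⟫_ℝ * ⟪cross3 q (r - r₀), v⟫_ℝ) = _
  push_cast
  ring

theorem curl_dipolePotential (q : E3) {r₀ r : E3} (hr : r ≠ r₀) (u v : E3) :
    fderiv ℝ (dipolePotential q r₀) r u v - fderiv ℝ (dipolePotential q r₀) r v u =
      -⟪cross3 u v, gradient (dipoleKernel q r₀) r⟫_ℝ := by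
  have hconst : ⟪cross3 q u, v⟫_ℝ - ⟪cross3 q v, u⟫_ℝ = 2 * ⟪cross3 u v, q⟫_ℝ := by
    rw [inner_cross3_left, inner_cross3_left, cross3_anticomm v u, inner_neg_right,
      real_inner_comm q]
    ring
  have hradial : ⟪r - r₀, u⟫_ℝ * ⟪cross3 q (r - r₀), v⟫_ℝ -
      ⟪r - r₀, v⟫_ℝ * ⟪cross3 q (r - r₀), u⟫_ℝ =
      ‖r - r₀‖ ^ 2 * ⟪cross3 u v, q⟫_ℝ - ⟪q, r - r₀⟫_ℝ * ⟪cross3 u v, r - r₀⟫_ℝ := by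
    rw [← real_inner_smul_right, ← real_inner_smul_right, ← inner_sub_right,
      ← cross3_cross3_right, inner_cross3_cross3, cross3_anticomm v u, inner_neg_right,
      inner_neg_right, real_inner_self_eq_norm_sq, real_inner_comm (cross3 u v) q,
      real_inner_comm (cross3 u v) (r - r₀)]
    ring
  rw [fderiv_dipolePotential_apply q hr, fderiv_dipolePotential_apply q hr,
    inner_gradient_dipoleKernel q _ hr]
  have hne : ‖r - r₀‖ ≠ 0 := norm_ne_zero_iff.2 (sub_ne_zero.2 hr)
  have hpow : (‖r - r₀‖ ^ 5)⁻¹ * ‖r - r₀‖ ^ 2 = (‖r - r₀‖ ^ 3)⁻¹ := by field_simp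
  linear_combination (‖r - r₀‖ ^ 3)⁻¹ * hconst - 3 * (‖r - r₀‖ ^ 5)⁻¹ * hradial -
    3 * ⟪cross3 u v, q⟫_ℝ * hpow

theorem curveIntegral_segment_dipolePotential (q r₀ a b : E3) :
    ∫ᶜ r in .segment a b, dipolePotential q r₀ r =
      (∫ t in (0 : ℝ)..1, (‖a - r₀ + t • (b - a)‖ ^ 3)⁻¹) * ⟪q, cross3 (a - r₀) (b - a)⟫_ℝ := by
  rw [curveIntegral_segment, ← intervalIntegral.integral_mul_const]
  refine intervalIntegral.integral_congr fun t _ => ?_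
  have hline : AffineMap.lineMap a b t - r₀ = a - r₀ + t • (b - a) := by
    rw [AffineMap.lineMap_apply_module']
    abel
  simp only [dipolePotential_apply, hline, inner_cross3_left, cross3_add_left, cross3_smul_left,
    cross3_self, smul_zero, add_zero]

variable {a b c : E3}

theorem integrableOn_inner_gradient_dipoleKernel (h : LinearIndependent ℝ ![b - a, c - a])
    (q w : E3) {r₀ : E3} (hr₀ : r₀ ∉ convexHull ℝ {a, b, c}) :
    IntegrableOn (fun r => ⟪w, gradient (dipoleKernel q r₀) r⟫_ℝ) (convexHull ℝ {a, b, c})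
      μHE[2] := by
  rw [← planeChart_image_stdTriangle] at hr₀ ⊢
  refine integrableOn_planeChart_image h (ContinuousOn.integrableOn_compact isCompact_stdTriangle
    fun z hz => ContinuousAt.continuousWithinAt ?_)
  exact (continuousAt_inner_gradient_dipoleKernel q w
    (ne_of_mem_of_not_mem (Set.mem_image_of_mem _ hz) hr₀)).comp
      (continuous_planeChart _ _ _).continuousAt

theorem setIntegral_inner_gradient_dipoleKernel (h : LinearIndependent ℝ ![b - a, c - a])
    (q : E3) {r₀ : E3} (hr₀ : r₀ ∉ convexHull ℝ {a, b, c}) :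
    ∫ r in convexHull ℝ {a, b, c}, ⟪‖cross3 (b - a) (c - a)‖⁻¹ • cross3 (b - a) (c - a),
        gradient (dipoleKernel q r₀) r⟫_ℝ ∂μHE[2] =
      -((∫ᶜ r in .segment a b, dipolePotential q r₀ r) +
        (∫ᶜ r in .segment b c, dipolePotential q r₀ r) +
        ∫ᶜ r in .segment c a, dipolePotential q r₀ r) := by
  have hne {r : E3} (hr : r ∈ convexHull ℝ {a, b, c}) : r ≠ r₀ := ne_of_mem_of_not_mem hr hr₀
  rw [← setIntegral_stdTriangle_curl (ω' := fderiv ℝ (dipolePotential q r₀))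
    (fun r hr => ((contDiffAt_dipolePotential q (hne hr)).differentiableAt
      one_ne_zero).hasFDerivAt)
    (fun r hr => ((contDiffAt_dipolePotential q (hne hr)).continuousAt_fderiv
      one_ne_zero).continuousWithinAt), ← planeChart_image_stdTriangle,
    setIntegral_planeChart_image h, parallelogramArea_eq_norm_cross3, ← integral_neg,
    ← integral_smul]
  refine setIntegral_congr_fun isCompact_stdTriangle.measurableSet fun z hz => ?_
  have hmem := planeChart_image_stdTriangle a b c ▸ Set.mem_image_of_mem _ hz
  simp only [curl_dipolePotential q (hne hmem), neg_neg, real_inner_smul_left, smul_eq_mul]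
  rw [mul_inv_cancel_left₀ (norm_ne_zero_iff.2 (cross3_ne_zero h))]

end Dipole

namespace Tri

variable {p : Fin 3 → E3}

theorem tri_eq_convexHull (p : Fin 3 → E3) : tri p = convexHull ℝ {p 0, p 1, p 2} := by
  rw [tri]
  congr 1
  ext x
  simp [Fin.exists_fin_succ, eq_comm]

theorem linearIndependent_edges (hp : AffineIndependent ℝ p) :
    LinearIndependent ℝ ![p 1 - p 0, p 2 - p 0] := by
  rw [affineIndependent_iff_linearIndependent_vsub ℝ p 0] at hp
  let e : Fin 2 → {i : Fin 3 // i ≠ 0} := ![⟨1, by decide⟩, ⟨2, by decide⟩]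
  have hedges : ![p 1 - p 0, p 2 - p 0] = fun i => p (e i) -ᵥ p 0 := by
    ext i : 1
    fin_cases i <;> rfl
  exact hedges ▸ hp.comp e (by decide)

theorem len_pos (hp : AffineIndependent ℝ p) (i : Fin 3) : 0 < len p i :=
  norm_pos_iff.2 (sub_ne_zero.2 (hp.injective.ne (by fin_cases i <;> decide)))

theorem len_smul_sHat (hp : AffineIndependent ℝ p) (i : Fin 3) : len p i • sHat p i = side p i :=
  smul_inv_smul₀ (len_pos hp i).ne' _

theorem norm_sHat (hp : AffineIndependent ℝ p) (i : Fin 3) : ‖sHat p i‖ = 1 := by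
  rw [sHat, norm_smul, norm_inv, len, norm_norm]
  exact inv_mul_cancel₀ (len_pos hp i).ne'

theorem wHat_eq (hp : AffineIndependent ℝ p) :
    wHat p = ‖cross3 (p 1 - p 0) (p 2 - p 0)‖⁻¹ • cross3 (p 1 - p 0) (p 2 - p 0) := by
  have hsides : cross3 (side p 0) (side p 1) = cross3 (p 1 - p 0) (p 2 - p 0) := by
    simp only [side, Fin.reduceSub, Fin.reduceAdd, cross3_sub_left, cross3_sub_right, cross3_self]
    rw [cross3_anticomm (p 2) (p 0), cross3_anticomm (p 1) (p 0)]
    abel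
  have hpos : 0 < (len p 0)⁻¹ * (len p 1)⁻¹ :=
    mul_pos (inv_pos.2 (len_pos hp 0)) (inv_pos.2 (len_pos hp 1))
  have hunit : cross3 (sHat p 0) (sHat p 1) =
      ((len p 0)⁻¹ * (len p 1)⁻¹) • cross3 (p 1 - p 0) (p 2 - p 0) := by
    rw [sHat, sHat, cross3_smul_left, cross3_smul_right, smul_smul, hsides]
  rw [wHat, hunit, norm_smul, Real.norm_of_nonneg hpos.le, mul_inv_rev, smul_smul,
    inv_mul_cancel_right₀ hpos.ne']

theorem norm_wHat (hp : AffineIndependent ℝ p) : ‖wHat p‖ = 1 := by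
  rw [wHat_eq hp, norm_smul, norm_inv, norm_norm,
    inv_mul_cancel₀ (norm_ne_zero_iff.2 (cross3_ne_zero (linearIndependent_edges hp)))]

theorem inner_node_wHat (hp : AffineIndependent ℝ p) (r₀ : E3) (j : Fin 3) :
    ⟪p j - r₀, wHat p⟫_ℝ = w0 p r₀ := by
  have hplane : ⟪p j - p 0, wHat p⟫_ℝ = 0 := by
    rw [wHat_eq hp, real_inner_smul_right]
    fin_cases j
    · simp
    · exact mul_eq_zero_of_right _ (inner_self_cross3 _ _)
    · exact mul_eq_zero_of_right _ (inner_cross3_self _ _)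
  rw [w0, ← sub_add_sub_cancel (p j) (p 0) r₀, inner_add_left, hplane, zero_add, ← inner_neg_left,
    neg_sub]

theorem inner_sHat (p : Fin 3 → E3) (r₀ x : E3) (i : Fin 3) :
    ⟪sHat p i, x⟫_ℝ = (⟪p (i - 1) - r₀, x⟫_ℝ - ⟪p (i + 1) - r₀, x⟫_ℝ) / len p i := by
  rw [sHat, side, real_inner_smul_left, ← inner_sub_left, sub_sub_sub_cancel_right, inv_mul_eq_div]

theorem inner_sHat_wHat (hp : AffineIndependent ℝ p) (i : Fin 3) : ⟪sHat p i, wHat p⟫_ℝ = 0 := by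
  rw [inner_sHat p 0, inner_node_wHat hp, inner_node_wHat hp, sub_self, zero_div]

theorem node_sub_eq (p : Fin 3 → E3) (r₀ : E3) (j : Fin 3) :
    p j - r₀ = ![0, side p 2, -side p 1] j + (p 0 - r₀) := by
  fin_cases j <;> simp [side]

theorem inner_node_uHat (hp : AffineIndependent ℝ p) (r₀ : E3) (j : Fin 3) :
    ⟪p j - r₀, uHat p⟫_ℝ = ![-u0 p r₀, len p 2 - u0 p r₀, u3 p - u0 p r₀] j := by
  have hside : ⟪side p 2, uHat p⟫_ℝ = len p 2 := by
    rw [← len_smul_sHat hp, uHat, real_inner_smul_left, real_inner_self_eq_norm_sq, norm_sHat hp]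
    ring
  have hbase : ⟪p 0 - r₀, uHat p⟫_ℝ = -u0 p r₀ := by rw [u0, ← inner_neg_left, neg_sub]
  rw [node_sub_eq, inner_add_left, hbase]
  fin_cases j <;> simp [hside, u3, sub_eq_add_neg]

theorem inner_node_vHat (hp : AffineIndependent ℝ p) (r₀ : E3) (j : Fin 3) :
    ⟪p j - r₀, vHat p⟫_ℝ = ![-v0 p r₀, -v0 p r₀, v3 p - v0 p r₀] j := by
  have hside : ⟪side p 2, vHat p⟫_ℝ = 0 := by
    rw [← len_smul_sHat hp, vHat, uHat, real_inner_smul_left, inner_cross3_self, mul_zero]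
  have hbase : ⟪p 0 - r₀, vHat p⟫_ℝ = -v0 p r₀ := by rw [v0, ← inner_neg_left, neg_sub]
  rw [node_sub_eq, inner_add_left, hbase]
  fin_cases j <;> simp [hside, v3, sub_eq_add_neg]

theorem t0_eq_inner (hp : AffineIndependent ℝ p) (r₀ : E3) (i : Fin 3) :
    t0 p r₀ i = ⟪p (i + 1) - r₀, mHat p i⟫_ℝ := by
  have hlen := (len_pos hp 2).ne'
  rw [mHat, cross3_unit_normal (norm_sHat hp 2) (inner_sHat_wHat hp 2), ← uHat, ← vHat,
    inner_sub_right, real_inner_smul_right, real_inner_smul_right, inner_sHat p r₀,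
    inner_sHat p r₀]
  simp only [inner_node_uHat hp, inner_node_vHat hp]
  fin_cases i <;>
    simp only [t0, Fin.zero_eta, Fin.mk_one, Fin.reduceFinMk, Fin.reduceAdd, Fin.reduceSub,
      Fin.isValue, Matrix.cons_val]
  · ring
  · ring
  · field_simp
    ring

theorem inner_node_sHat (hp : AffineIndependent ℝ p) (r₀ : E3) (i j : Fin 3) :
    ⟪p j - r₀, sHat p i⟫_ℝ = ⟪p j - r₀, uHat p⟫_ℝ * ⟪sHat p i, uHat p⟫_ℝ +
      ⟪p j - r₀, vHat p⟫_ℝ * ⟪sHat p i, vHat p⟫_ℝ :=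
  inner_eq_of_inner_unit_normal_eq_zero (norm_sHat hp 2) (norm_wHat hp) (inner_sHat_wHat hp 2) _
    (inner_sHat_wHat hp i)

theorem sMinus_eq_inner (hp : AffineIndependent ℝ p) (r₀ : E3) (i : Fin 3) :
    sMinus p r₀ i = ⟪p (i + 1) - r₀, sHat p i⟫_ℝ := by
  have hlen := (len_pos hp 2).ne'
  rw [inner_node_sHat hp, inner_sHat p r₀, inner_sHat p r₀]
  simp only [inner_node_uHat hp, inner_node_vHat hp]
  fin_cases i <;>
    simp only [sMinus, Fin.zero_eta, Fin.mk_one, Fin.reduceFinMk, Fin.reduceAdd, Fin.reduceSub,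
      Fin.isValue, Matrix.cons_val]
  · ring
  · ring
  · field_simp
    ring

theorem sPlus_eq_inner (hp : AffineIndependent ℝ p) (r₀ : E3) (i : Fin 3) :
    sPlus p r₀ i = ⟪p (i - 1) - r₀, sHat p i⟫_ℝ := by
  have hlen := (len_pos hp 2).ne'
  rw [inner_node_sHat hp, inner_sHat p r₀, inner_sHat p r₀]
  simp only [inner_node_uHat hp, inner_node_vHat hp]
  fin_cases i <;>
    simp only [sPlus, Fin.zero_eta, Fin.mk_one, Fin.reduceFinMk, Fin.reduceAdd, Fin.reduceSub,
      Fin.isValue, Matrix.cons_val]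
  · ring
  · ring
  · field_simp
    ring

theorem cross3_sHat_node (hp : AffineIndependent ℝ p) (r₀ : E3) (i : Fin 3) :
    cross3 (sHat p i) (p (i + 1) - r₀) = w0 p r₀ • mHat p i - t0 p r₀ i • wHat p := by
  rw [cross3_eq_of_unit_normal (norm_wHat hp) (inner_sHat_wHat hp i), inner_node_wHat hp,
    t0_eq_inner hp, mHat]

theorem norm_cross3_sHat_node (hp : AffineIndependent ℝ p) (r₀ : E3) (i : Fin 3) :
    ‖cross3 (sHat p i) (p (i + 1) - r₀)‖ = R0 p r₀ i := by
  have hm : ‖mHat p i‖ ^ 2 = 1 := by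
    rw [mHat, norm_cross3_sq, norm_sHat hp, norm_wHat hp, inner_sHat_wHat hp]
    ring
  have hmw : ⟪mHat p i, wHat p⟫_ℝ = 0 := by rw [real_inner_comm, mHat, inner_cross3_self]
  rw [R0, eq_comm, Real.sqrt_eq_iff_eq_sq (by positivity) (norm_nonneg _), cross3_sHat_node hp,
    norm_sub_sq_real, real_inner_smul_left, real_inner_smul_right, hmw, norm_smul, norm_smul,
    mul_pow, mul_pow, hm, norm_wHat hp, Real.norm_eq_abs, Real.norm_eq_abs, sq_abs, sq_abs]
  ring

theorem cross3_sHat_node_sub_one (hp : AffineIndependent ℝ p) (r₀ : E3) (i : Fin 3) :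
    cross3 (sHat p i) (p (i - 1) - r₀) = cross3 (sHat p i) (p (i + 1) - r₀) := by
  rw [← sub_eq_zero, ← cross3_sub_right, sub_sub_sub_cancel_right, ← side, ← len_smul_sHat hp,
    cross3_smul_right, cross3_self, smul_zero]

theorem RMinus_eq_norm (hp : AffineIndependent ℝ p) (r₀ : E3) (i : Fin 3) :
    RMinus p r₀ i = ‖p (i + 1) - r₀‖ := by
  rw [norm_eq_sqrt_inner_sq_add_norm_cross3_sq (norm_sHat hp i), norm_cross3_sHat_node hp,
    ← sMinus_eq_inner hp, R0, Real.sq_sqrt (by positivity), ← add_assoc, RMinus]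

theorem RPlus_eq_norm (hp : AffineIndependent ℝ p) (r₀ : E3) (i : Fin 3) :
    RPlus p r₀ i = ‖p (i - 1) - r₀‖ := by
  rw [norm_eq_sqrt_inner_sq_add_norm_cross3_sq (norm_sHat hp i), cross3_sHat_node_sub_one hp,
    norm_cross3_sHat_node hp, ← sPlus_eq_inner hp, R0, Real.sq_sqrt (by positivity), ← add_assoc,
    RPlus]

theorem integral_inv_norm_side_pow_three (hp : AffineIndependent ℝ p) {r₀ : E3} {i : Fin 3}
    (hR0 : R0 p r₀ i ≠ 0) :
    ∫ t in (0 : ℝ)..1, (‖p (i + 1) - r₀ + t • side p i‖ ^ 3)⁻¹ = Rs p r₀ i / len p i := by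
  have hlen := (len_pos hp i).ne'
  have hgram : ‖p (i + 1) - r₀‖ ^ 2 * ‖side p i‖ ^ 2 - ⟪p (i + 1) - r₀, side p i⟫_ℝ ^ 2 =
      (len p i * R0 p r₀ i) ^ 2 := by
    rw [← norm_cross3_sq, ← len_smul_sHat hp, cross3_smul_right, cross3_anticomm, norm_smul,
      norm_neg, norm_cross3_sHat_node hp, Real.norm_of_nonneg (len_pos hp i).le]
  have hend : p (i + 1) - r₀ + side p i = p (i - 1) - r₀ := by rw [side]; abel
  rw [integral_inv_norm_add_smul_pow_three (by rw [hgram]; positivity), hgram, hend,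
    ← len_smul_sHat hp, real_inner_smul_right, real_inner_smul_right, ← sPlus_eq_inner hp,
    ← sMinus_eq_inner hp, ← RPlus_eq_norm hp, ← RMinus_eq_norm hp, Rs]
  field_simp

theorem curveIntegral_side_dipolePotential (hp : AffineIndependent ℝ p) (q r₀ : E3) (i : Fin 3) :
    ∫ᶜ r in .segment (p (i + 1)) (p (i - 1)), dipolePotential q r₀ r =
      -⟪q, Rs p r₀ i • (w0 p r₀ • mHat p i - t0 p r₀ i • wHat p)⟫_ℝ := by
  rw [curveIntegral_segment_dipolePotential, ← side, ← cross3_sHat_node hp, cross3_anticomm,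
    inner_neg_right, mul_neg]
  nth_rw 2 [← len_smul_sHat hp]
  rw [cross3_smul_left, real_inner_smul_right, real_inner_smul_right, neg_inj]
  rcases eq_or_ne (R0 p r₀ i) 0 with hR0 | hR0
  · rw [← norm_cross3_sHat_node hp, norm_eq_zero] at hR0
    rw [hR0, inner_zero_right, mul_zero, mul_zero, mul_zero]
  · rw [integral_inv_norm_side_pow_three hp hR0, ← mul_assoc, div_mul_cancel₀ _ (len_pos hp i).ne']

end Tri

theorem mainTheorem1 (p : Fin 3 → E3) (hp : AffineIndependent ℝ p) (q r₀ : E3)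
    (hr₀ : r₀ ∉ Tri.tri p) :
    IntegrableOn (fun r : E3 => ⟪Tri.wHat p, gradient (dipoleKernel q r₀) r⟫_ℝ)
        (Tri.tri p) μHE[2] ∧
      ∫ r in Tri.tri p, ⟪Tri.wHat p, gradient (dipoleKernel q r₀) r⟫_ℝ ∂μHE[2] =
        ⟪q, ∑ i : Fin 3, Tri.Rs p r₀ i •
          (Tri.w0 p r₀ • Tri.mHat p i - Tri.t0 p r₀ i • Tri.wHat p)⟫_ℝ := by
  have hedges := Tri.linearIndependent_edges hp
  rw [Tri.tri_eq_convexHull] at hr₀ ⊢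
  refine ⟨integrableOn_inner_gradient_dipoleKernel hedges q (Tri.wHat p) hr₀, ?_⟩
  have hstokes := setIntegral_inner_gradient_dipoleKernel hedges q hr₀
  rw [← Tri.wHat_eq hp] at hstokes
  have hside₁ : ∫ᶜ r in .segment (p 1) (p 2), dipolePotential q r₀ r = _ :=
    Tri.curveIntegral_side_dipolePotential hp q r₀ 0
  have hside₂ : ∫ᶜ r in .segment (p 2) (p 0), dipolePotential q r₀ r = _ :=
    Tri.curveIntegral_side_dipolePotential hp q r₀ 1
  have hside₃ : ∫ᶜ r in .segment (p 0) (p 1), dipolePotential q r₀ r = _ :=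
    Tri.curveIntegral_side_dipolePotential hp q r₀ 2
  rw [hstokes, hside₁, hside₂, hside₃, inner_sum, Fin.sum_univ_three]
  ring
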